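/- Let $X$ be a compact metric space with metric $d$, let $f:X\to X$ be continuous, let $\nu$ be an ergodic $f$-invariant Borel probability measure on $X$, and let $\varphi:X\to\mathbb R$ be continuous. Write $\mathcal M(X)$ for the space of Borel probability measures on $X$ with the weak topology, $S_n\varphi(x)=\sum_{i=0}^{n-1}\varphi(f^i x)$, and $h_\nu(f)\in[0,\infty]$ for the Kolmogorov–Sinai entropy. For $n\ge 1$ and $F\subset\mathcal M(X)$ put $$X_{n,F}=\Big\{x\in X:\ \frac1n\sum_{k=0}^{n-1}\delta_{f^k x}\in F\Big\}.$$ For $\delta,\epsilon>0$, a set $A\subset X$ is called $(\delta,n,\epsilon)$-separated if any two distinct points $x,y\in A$ satisfy $\#\{j: 0\le j\le n-1,\ d(f^j x,f^j y)>\epsilon\}\ge \delta n$. Let $\eta>0$ and let $h$ be a real number with $h\le h_\nu(f)$ (in particular, $h=h_\nu(f)$ is allowed when $h_\nu(f)<\infty$). Then there exist $\delta^*>0$ and $\epsilon^*>0$ such that for every neighborhood $F$ of $\nu$ in $\mathcal M(X)$ there is $n^*_{F,\nu}\in\mathbb N$ such that for every integer $n\ge 1$ with $n\ge n^*_{F,\nu}$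 there exists a finite $(\delta^*,n,\epsilon^*)$-separated set $\Gamma_n\subset X_{n,F}$ with $$\sum_{x\in\Gamma_n}e^{S_n\varphi(x)}\ \ge\ \exp\Big[n\Big(h+\int_X\varphi\,d\nu-\eta\Big)\Big].$$ -/

import Mathlib

open MeasureTheory Filter Topology

noncomputable section

/-- The entropy `H(μ, ξ) = -∑ μ(A_i) log μ(A_i)` of the finite partition of `X` into the fibres
`A_i = ξ⁻¹{i}` of a labelling `ξ : X → ι` (empty fibres contribute `0`). -/
def partitionEntropy {X ι : Type*} [MeasurableSpace X] [Fintype ι]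
    (μ : Measure X) (ξ : X → ι) : ℝ :=
  ∑ i, Real.negMulLog (μ.real (ξ ⁻¹' {i}))

/-- The labelling of the refined partition `ξ^n = ⋁_{i < n} f^{-i} ξ`: a point is labelled by the
word `(ξ x, ξ (f x), …, ξ (f^{n-1} x))`. -/
def refinedPartition {X ι : Type*} (f : X → X) (ξ : X → ι) (n : ℕ) : X → (Fin n → ι) :=
  fun x i => ξ (f^[i] x)

/-- The entropy `h_μ(f, ξ) = lim_n (1/n) H(μ, ξ^n)` of `f` relative to a finite partition `ξ`.
For an `f`-invariant probability measure the sequence `H(μ, ξ^n)` is subadditive, so the limit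
exists and coincides with the `liminf` used here. -/
def partitionEntropyRate {X ι : Type*} [MeasurableSpace X] [Fintype ι]
    (f : X → X) (μ : Measure X) (ξ : X → ι) : EReal :=
  liminf (fun n : ℕ => ((partitionEntropy μ (refinedPartition f ξ n) / n : ℝ) : EReal)) atTop

/-- The Kolmogorov–Sinai entropy `h_μ(f) ∈ [0, ∞]`: the supremum of `h_μ(f, ξ)` over all finite
measurable partitions `ξ` of `X`. -/
def ksEntropy {X : Type*} [MeasurableSpace X] (f : X → X) (μ : Measure X) : EReal :=
  ⨆ (k : ℕ) (ξ : X → Fin k) (_ : Measurable ξ), partitionEntropyRate f μ ξ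

/-- The set `A` is `(δ, n, ε)`-separated for `f`: any two distinct points `x, y` of `A` satisfy
`#{j : 0 ≤ j ≤ n - 1, d(f^j x, f^j y) > ε} ≥ δ n`. -/
def IsDeltaSeparated {X : Type*} [MetricSpace X] (f : X → X) (δ : ℝ) (n : ℕ) (ε : ℝ)
    (A : Set X) : Prop :=
  ∀ x ∈ A, ∀ y ∈ A, x ≠ y →
    δ * n ≤ (((Finset.range n).filter fun j => ε < dist (f^[j] x) (f^[j] y)).card : ℝ)

/-- The empirical measure `(1/n) ∑_{k < n} δ_{f^k x}`. It is a probability measure for `n ≥ 1`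
(and the zero measure for `n = 0`). -/
def empiricalMeasure {X : Type*} [MeasurableSpace X] (f : X → X) (n : ℕ) (x : X) : Measure X :=
  (n : ENNReal)⁻¹ • ∑ k ∈ Finset.range n, Measure.dirac (f^[k] x)

/-- `X_{n,F}`: the set of points whose empirical measure of length `n` belongs to the set `F` of
probability measures. -/
def empiricalSet {X : Type*} [MeasurableSpace X] (f : X → X) (n : ℕ)
    (F : Set (ProbabilityMeasure X)) : Set X :=
  {x | ∃ μ ∈ F, (μ : Measure X) = empiricalMeasure f n x}

end

/-! ### Mean ergodic theorem in `L²`. -/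

section MeanErgodic

variable {X : Type*} [MeasurableSpace X] {f : X → X} {μ : Measure X}

/-! Choose a finite partition `ξ` with entropy rate above `h - η/8`. For large `n`, outside a set of
`ν`-measure `ρ`, points have empirical measure in `F`, Birkhoff sum of `φ` at least `n (∫ φ - η/4)`,
and few visits to a small set `B` off which `ε`-close points share a `ξ`-label. Call the set of such
points `G`. By Gibbs' inequality (`partitionEntropy_le`), the entropy of `ξ^n` forces `G` to carry
about `exp (n h)` names.

Take a maximal separated set `Γ` among representatives of these names. Every representative is
`ε`-close to some point of `Γ` at most times, so their names differ in a small proportion of places.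
A Hamming ball of that radius is exponentially small (`card_hammingDist_le`), hence `Γ` has nearly
as many points as `G` has names (`exists_isDeltaSeparated_card_le`). Only convergence in measure of
Birkhoff averages is used. -/

theorem memLp_comp_iterate (hf : MeasurePreserving f μ μ) {g : X → ℝ} (hg : MemLp g 2 μ) (n : ℕ) :
    MemLp (g ∘ f^[n]) 2 μ :=
  hg.comp_measurePreserving (hf.iterate n)

theorem memLp_birkhoffSum (hf : MeasurePreserving f μ μ) {g : X → ℝ} (hg : MemLp g 2 μ) (n : ℕ) :
    MemLp (birkhoffSum f g n) 2 μ := by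
  have : birkhoffSum f g n = fun x => ∑ k ∈ Finset.range n, (g ∘ f^[k]) x := rfl
  rw [this]
  exact memLp_finsetSum _ fun k _ => memLp_comp_iterate hf hg k

/-- The Birkhoff sums of the Koopman operator on `L²` are the classes of the Birkhoff sums. -/
theorem birkhoffSum_koopman (hf : MeasurePreserving f μ μ) {g : X → ℝ} (hg : MemLp g 2 μ)
    (n : ℕ) :
    birkhoffSum (Lp.compMeasurePreservingₗᵢ ℝ f hf : Lp ℝ 2 μ → Lp ℝ 2 μ) _root_.id n (hg.toLp g)
      = (memLp_birkhoffSum hf hg n).toLp _ := by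
  have hiter : ∀ k, (Lp.compMeasurePreservingₗᵢ ℝ f hf : Lp ℝ 2 μ → Lp ℝ 2 μ)^[k] (hg.toLp g)
      = (memLp_comp_iterate hf hg k).toLp _ := by
    intro k
    induction k with
    | zero => rfl
    | succ k ih =>
      rw [Function.iterate_succ_apply', ih]
      exact (Lp.toLp_compMeasurePreserving (memLp_comp_iterate hf hg k) hf)
  induction n with
  | zero =>
    rw [birkhoffSum_zero]
    symm
    convert MemLp.toLp_zero _ using 2
    · rw [birkhoffSum_zero']
    · exact MemLp.zero
  | succ n ih =>
    rw [birkhoffSum_succ, ih, id, hiter, ← MemLp.toLp_add]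
    congr 1
    exact funext fun x => (birkhoffSum_succ f g n x).symm

/-- The mean ergodic theorem for an ergodic map: Birkhoff averages of a square integrable function
converge in measure to its integral. -/
theorem Ergodic.tendstoInMeasure_birkhoffAverage [IsProbabilityMeasure μ] (hf : Ergodic f μ)
    {g : X → ℝ} (hg : MemLp g 2 μ) :
    TendstoInMeasure μ (fun n => birkhoffAverage ℝ f g n) atTop (fun _ => ∫ x, g x ∂μ) := by
  have hp := hf.toMeasurePreserving
  set U : Lp ℝ 2 μ →L[ℝ] Lp ℝ 2 μ :=
    (Lp.compMeasurePreservingₗᵢ ℝ f hp).toContinuousLinearMap with hU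
  have hU1 : ‖U‖ ≤ 1 := LinearIsometry.norm_toContinuousLinearMap_le _
  have hlim := U.tendsto_birkhoffAverage_orthogonalProjection hU1 (hg.toLp g)
  set K := U.eqLocus (1 : Lp ℝ 2 μ →L[ℝ] Lp ℝ 2 μ) with hK
  set P : Lp ℝ 2 μ := (K.orthogonalProjectionOnto (hg.toLp g) : Lp ℝ 2 μ) with hP
  have hPU : Lp.compMeasurePreserving f hp P = P := by
    have : P ∈ K := SetLike.coe_mem _
    exact this
  -- The limit of the averages is the projection to the `U`-fixed vectors; ergodicity makes it
  -- constant.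
  obtain ⟨c, hc⟩ : ∃ c, P =ᵐ[μ] Function.const X c := by
    refine hf.ae_eq_const_of_ae_eq_comp_ae (Lp.aestronglyMeasurable P) ?_
    exact ((Lp.coeFn_compMeasurePreserving P hp).symm.trans (by rw [hPU]))
  let one : Lp ℝ 2 μ := indicatorConstLp 2 MeasurableSet.univ (measure_ne_top μ _) (1 : ℝ)
  have hone : one ∈ K := by
    change Lp.compMeasurePreserving f hp one = one
    simp only [one]
    rw [MeasureTheory.Lp.indicatorConstLp_compMeasurePreserving]
    rfl
  have hinner : ∀ v : Lp ℝ 2 μ, inner ℝ one v = ∫ x, v x ∂μ := by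
    intro v
    simp only [one]
    rw [L2.inner_indicatorConstLp_one, Measure.restrict_univ]
  -- The constant function 1 is itself fixed, so projecting does not change the pairing with it,
  -- that is, the integral.
  have hcval : c = ∫ x, g x ∂μ := by
    have h1 : inner ℝ one P = inner ℝ one (hg.toLp g) := by
      have := K.inner_orthogonalProjectionOnto_eq_of_mem_left ⟨one, hone⟩ (hg.toLp g)
      exact this
    rw [hinner, hinner, integral_congr_ae hc, integral_congr_ae hg.coeFn_toLp] at h1
    simpa using h1
  have h2 := tendstoInMeasure_of_tendsto_Lp hlim
  refine h2.congr (fun n => ?_) (hc.trans (by rw [hcval]; rfl))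
  have h3 : birkhoffAverage ℝ U _root_.id n (hg.toLp g)
      = (n : ℝ)⁻¹ • (memLp_birkhoffSum hp hg n).toLp _ := by
    rw [birkhoffAverage]
    congr 1
    exact birkhoffSum_koopman hp hg n
  rw [h3]
  filter_upwards [Lp.coeFn_smul ((n : ℝ)⁻¹) ((memLp_birkhoffSum hp hg n).toLp _),
    (memLp_birkhoffSum hp hg n).coeFn_toLp] with x hx hx'
  rw [hx, Pi.smul_apply, hx']
  rfl

end MeanErgodic

/-! ### Entropy and counting estimates. -/

section Combinatorics

/-- Gibbs' inequality: if the labels outside `W` have total mass at most `ρ`, then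
`H(μ, ξ) ≤ log 2 + log #W + ρ log #ι`. -/
theorem partitionEntropy_le {X ι : Type*} [MeasurableSpace X] [Fintype ι] [MeasurableSpace ι]
    [MeasurableSingletonClass ι] (μ : Measure X) [IsProbabilityMeasure μ] {ξ : X → ι}
    (hξ : Measurable ξ) {W : Finset ι} (hW : W.Nonempty) {ρ : ℝ}
    (hρ : μ.real {x | ξ x ∉ W} ≤ ρ) :
    partitionEntropy μ ξ ≤ Real.log 2 + Real.log W.card + ρ * Real.log (Fintype.card ι) := by
  classical
  set p : ι → ℝ := fun i => μ.real (ξ ⁻¹' {i}) with hp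
  have hp0 : ∀ i, 0 ≤ p i := fun i => measureReal_nonneg
  have hsum : ∀ S : Finset ι, ∑ i ∈ S, p i = μ.real (ξ ⁻¹' (S : Set ι)) := fun S =>
    sum_measureReal_preimage_singleton S fun i _ => hξ (measurableSet_singleton i)
  have hp1 : ∑ i, p i = 1 := by rw [hsum]; simp
  have hpc : ∑ i ∈ Wᶜ, p i ≤ ρ := by
    rw [hsum]
    convert hρ using 2
    ext x; simp
  have hWpos : (0 : ℝ) < W.card := by exact_mod_cast hW.card_pos
  have hNpos : (0 : ℝ) < Fintype.card ι := by
    exact_mod_cast hW.card_pos.trans_le (Finset.card_le_univ W)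
  have hN1 : (1 : ℝ) ≤ Fintype.card ι := by
    have : 1 ≤ Fintype.card ι := hW.card_pos.trans_le (Finset.card_le_univ W)
    exact_mod_cast this
  -- Reference weights: mass 1/2 spread evenly over `W`, and at most 1/2 outside it. Total mass at
  -- most 1 suffices for Gibbs.
  set q : ι → ℝ := fun i => if i ∈ W then (2 * (W.card : ℝ))⁻¹ else (2 * (Fintype.card ι : ℝ))⁻¹
    with hq
  have hq0 : ∀ i, 0 < q i := by intro i; simp only [hq]; split_ifs <;> positivity
  have hqsum : ∑ i, q i ≤ 1 := by
    rw [← Finset.sum_add_sum_compl W]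
    have h1 : ∑ i ∈ W, q i = 1 / 2 := by
      rw [Finset.sum_congr rfl (g := fun _ => (2 * (W.card : ℝ))⁻¹)
        (fun i hi => by simp [hq, hi])]
      rw [Finset.sum_const, nsmul_eq_mul]; field_simp
    have h2 : ∑ i ∈ Wᶜ, q i ≤ 1 / 2 := by
      rw [Finset.sum_congr rfl (g := fun _ => (2 * (Fintype.card ι : ℝ))⁻¹)
        (fun i hi => by simp [hq, Finset.mem_compl.1 hi])]
      rw [Finset.sum_const, nsmul_eq_mul]
      have : ((Wᶜ).card : ℝ) ≤ Fintype.card ι := by exact_mod_cast Finset.card_le_univ _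
      rw [mul_inv, ← mul_assoc, ← div_eq_mul_inv, div_le_iff₀ hNpos]
      linarith
    linarith
  have hgibbs : ∀ i, Real.negMulLog (p i) ≤ p i * (-Real.log (q i)) + (q i - p i) := by
    intro i
    rcases (hp0 i).eq_or_lt with h0 | h0
    · rw [← h0]; simpa using (hq0 i).le
    · have := Real.log_le_sub_one_of_pos (div_pos (hq0 i) h0)
      rw [Real.log_div (hq0 i).ne' h0.ne'] at this
      have h2 := mul_le_mul_of_nonneg_left this h0.le
      rw [mul_sub, mul_sub, mul_div_cancel₀ _ h0.ne'] at h2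
      rw [Real.negMulLog]; linarith
  have hlogN : 0 ≤ Real.log (Fintype.card ι) := Real.log_nonneg hN1
  have hlogW : 0 ≤ Real.log W.card := Real.log_nonneg (by exact_mod_cast hW.card_pos)
  calc partitionEntropy μ ξ = ∑ i, Real.negMulLog (p i) := rfl
    _ ≤ ∑ i, (p i * (-Real.log (q i)) + (q i - p i)) := Finset.sum_le_sum fun i _ => hgibbs i
    _ = ∑ i, p i * (-Real.log (q i)) + (∑ i, q i - 1) := by
        rw [Finset.sum_add_distrib, Finset.sum_sub_distrib, hp1]
    _ ≤ ∑ i, p i * (-Real.log (q i)) := by linarith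
    _ = ∑ i ∈ W, p i * (Real.log 2 + Real.log W.card)
        + ∑ i ∈ Wᶜ, p i * (Real.log 2 + Real.log (Fintype.card ι)) := by
        rw [← Finset.sum_add_sum_compl W]
        congr 1
        · refine Finset.sum_congr rfl fun i hi => ?_
          simp only [hq, hi, if_true]
          rw [Real.log_inv, neg_neg, Real.log_mul two_ne_zero hWpos.ne']
        · refine Finset.sum_congr rfl fun i hi => ?_
          simp only [hq, Finset.mem_compl.1 hi, if_false]
          rw [Real.log_inv, neg_neg, Real.log_mul two_ne_zero hNpos.ne']
    _ = Real.log 2 * (∑ i, p i) + (∑ i ∈ W, p i) * Real.log W.card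
        + (∑ i ∈ Wᶜ, p i) * Real.log (Fintype.card ι) := by
        rw [← Finset.sum_mul, ← Finset.sum_mul, ← Finset.sum_add_sum_compl W]; ring
    _ ≤ Real.log 2 + Real.log W.card + ρ * Real.log (Fintype.card ι) := by
        have h1 : ∑ i ∈ W, p i ≤ 1 := hp1 ▸
          Finset.sum_le_sum_of_subset_of_nonneg (Finset.subset_univ W) fun i _ _ => hp0 i
        have h2 := mul_le_mul_of_nonneg_right h1 hlogW
        have h3 := mul_le_mul_of_nonneg_right hpc hlogN
        rw [hp1]; linarith

/-- A Hamming ball of radius `r` in `αⁿ` has at most `t⁻ʳ (1 + #α t)ⁿ` elements (`0 < t ≤ 1`). -/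
theorem card_hammingDist_le {α : Type*} [Fintype α] [DecidableEq α] {n : ℕ} (w : Fin n → α)
    {t : ℝ} (ht0 : 0 < t) (ht1 : t ≤ 1) (r : ℝ) :
    ((Finset.univ.filter fun v : Fin n → α => (hammingDist v w : ℝ) ≤ r).card : ℝ)
      ≤ Real.exp (r * Real.log t⁻¹ + n * (Fintype.card α * t)) := by
  have hlog : Real.log t ≤ 0 := Real.log_nonpos ht0.le ht1
  -- Chernoff-type bound: weight `t` per mismatch makes the sum over all words factor over
  -- coordinates, while each word of the ball weighs at least `t ^ r` because `t ≤ 1`.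
  have hprod : ∀ v : Fin n → α, ∏ i, (if v i = w i then 1 else t) = t ^ hammingDist v w := by
    intro v
    rw [hammingDist, Finset.prod_ite, Finset.prod_const_one, one_mul, Finset.prod_const]
  have htot : ∑ v : Fin n → α, t ^ hammingDist v w ≤ Real.exp (n * (Fintype.card α * t)) := by
    simp_rw [← hprod]
    rw [← Fintype.piFinset_univ,
      ← Finset.prod_univ_sum (fun _ => Finset.univ) (fun i a => if a = w i then (1 : ℝ) else t)]
    have hfac : ∀ i : Fin n, ∑ a : α, (if a = w i then (1 : ℝ) else t)
        ≤ Real.exp (Fintype.card α * t) := by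
      intro i
      calc ∑ a : α, (if a = w i then (1 : ℝ) else t)
          ≤ ∑ a : α, ((if a = w i then (1 : ℝ) else 0) + t) := by
            refine Finset.sum_le_sum fun a _ => ?_
            split_ifs <;> linarith
        _ = Fintype.card α * t + 1 := by
            rw [Finset.sum_add_distrib]; simp [add_comm]
        _ ≤ _ := Real.add_one_le_exp _
    calc _ ≤ ∏ _i : Fin n, Real.exp (Fintype.card α * t) :=
          Finset.prod_le_prod (fun i _ => Finset.sum_nonneg fun a _ => by split_ifs <;> positivity)
            fun i _ => hfac i
      _ = _ := by rw [Finset.prod_const, ← Real.exp_nat_mul]; simp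
  set S := Finset.univ.filter fun v : Fin n → α => (hammingDist v w : ℝ) ≤ r
  have hS : (S.card : ℝ) * Real.exp (r * Real.log t) ≤ Real.exp (n * (Fintype.card α * t)) := by
    refine le_trans ?_ htot
    rw [← nsmul_eq_mul, ← Finset.sum_const]
    refine (Finset.sum_le_sum fun v hv => ?_).trans
      (Finset.sum_le_sum_of_subset_of_nonneg (Finset.subset_univ S) fun v _ _ => by positivity)
    rw [← Real.exp_log (pow_pos ht0 _), Real.log_pow]
    exact Real.exp_le_exp.2 (mul_le_mul_of_nonpos_right (Finset.mem_filter.1 hv).2 hlog)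
  rw [Real.exp_add, Real.log_inv, mul_neg, Real.exp_neg, mul_comm, ← div_eq_mul_inv,
    le_div_iff₀ (Real.exp_pos _)]
  exact hS

/-- A symmetric relation on a finite set has a maximal "separated" subset; every other element is
unseparated from one of its members. -/
theorem exists_maximal_pairwise {α : Type*} (R : Finset α) (r : α → α → Prop)
    (hr : ∀ x y, r x y → r y x) :
    ∃ Γ ⊆ R, (∀ x ∈ Γ, ∀ y ∈ Γ, x ≠ y → r x y) ∧ ∀ y ∈ R, ∃ x ∈ Γ, x = y ∨ ¬ r x y := by
  classical
  obtain ⟨Γ, hΓ, hmax⟩ := Finset.exists_max_image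
    (R.powerset.filter fun Γ : Finset α => (Γ : Set α).Pairwise r) Finset.card
    ⟨∅, by simp⟩
  rw [Finset.mem_filter, Finset.mem_powerset] at hΓ
  refine ⟨Γ, hΓ.1, fun x hx y hy => hΓ.2 hx hy, fun y hy => ?_⟩
  by_contra! hcon
  have hyΓ : y ∉ Γ := fun h => (hcon y h).1 rfl
  have := hmax (insert y Γ) (by
    rw [Finset.mem_filter, Finset.mem_powerset]
    refine ⟨Finset.insert_subset hy hΓ.1, fun a ha b hb hab => ?_⟩
    rcases Finset.mem_insert.1 (Finset.mem_coe.1 ha) with rfl | ha' <;>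
      rcases Finset.mem_insert.1 (Finset.mem_coe.1 hb) with rfl | hb'
    · exact absurd rfl hab
    · exact hr _ _ (hcon b hb').2
    · exact (hcon a ha').2
    · exact hΓ.2 ha' hb' hab)
  rw [Finset.card_insert_of_notMem hyΓ] at this
  omega

end Combinatorics

/-! ### Convergence of empirical measures in probability. -/

section Empirical

variable {X : Type*} [MeasurableSpace X]

theorem isProbabilityMeasure_empiricalMeasure (f : X → X) {n : ℕ} (hn : n ≠ 0) (x : X) :
    IsProbabilityMeasure (empiricalMeasure f n x) := by
  constructor
  simp only [empiricalMeasure, Measure.smul_apply, Measure.finsetSum_apply, measure_univ,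
    Finset.sum_const, Finset.card_range, nsmul_eq_mul, mul_one, smul_eq_mul]
  exact ENNReal.inv_mul_cancel (by exact_mod_cast hn) (ENNReal.natCast_ne_top n)

theorem integral_empiricalMeasure (f : X → X) (n : ℕ) (x : X) {g : X → ℝ}
    (hg : StronglyMeasurable g) :
    ∫ y, g y ∂(empiricalMeasure f n x) = birkhoffAverage ℝ f g n x := by
  rw [empiricalMeasure, integral_smul_measure, integral_finsetSum_measure]
  · simp only [integral_dirac' g _ hg, ENNReal.toReal_inv, ENNReal.toReal_natCast]
    rfl
  · intro k _
    exact integrable_dirac' hg (by finiteness)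

theorem empiricalSet_inter (f : X → X) (n : ℕ)
    (F G : Set (ProbabilityMeasure X)) :
    empiricalSet f n (F ∩ G) = empiricalSet f n F ∩ empiricalSet f n G := by
  ext x
  constructor
  · rintro ⟨μ, hμ, h⟩
    exact ⟨⟨μ, hμ.1, h⟩, ⟨μ, hμ.2, h⟩⟩
  · rintro ⟨⟨μ, hμ, h⟩, ⟨μ', hμ', h'⟩⟩
    have : μ = μ' := Subtype.ext (h.trans h'.symm)
    exact ⟨μ, ⟨hμ, this ▸ hμ'⟩, h⟩

theorem empiricalSet_mono (f : X → X) (n : ℕ) {F G : Set (ProbabilityMeasure X)} (h : F ⊆ G) :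
    empiricalSet f n F ⊆ empiricalSet f n G :=
  fun _ ⟨μ, hμ, hx⟩ => ⟨μ, h hμ, hx⟩

/-- The sets of probability measures that contain the empirical measures with `ν`-probability
tending to one form a filter. -/
def empiricalFilter (f : X → X) (ν : Measure X) :
    Filter (ProbabilityMeasure X) where
  sets := {F | Tendsto (fun n => ν (empiricalSet f n F)ᶜ) atTop (𝓝 0)}
  univ_sets := by
    refine tendsto_const_nhds.congr' ?_
    -- At `n = 0` the empirical measure is zero, so `empiricalSet` is empty.
    filter_upwards [eventually_ne_atTop 0] with n hn
    have : empiricalSet f n Set.univ = Set.univ := Set.eq_univ_of_forall fun x =>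
      ⟨⟨_, isProbabilityMeasure_empiricalMeasure f hn x⟩, trivial, rfl⟩
    simp [this]
  sets_of_superset := fun {F G} hF h =>
    tendsto_of_tendsto_of_tendsto_of_le_of_le tendsto_const_nhds hF (fun _ => zero_le)
      fun n => measure_mono (Set.compl_subset_compl.2 (empiricalSet_mono f n h))
  inter_sets := fun {F G} hF hG => by
    have h := Tendsto.add hF hG
    rw [add_zero] at h
    refine tendsto_of_tendsto_of_tendsto_of_le_of_le tendsto_const_nhds h (fun _ => zero_le)
      fun n => ?_
    simp only [empiricalSet_inter, Set.compl_inter]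
    exact measure_union_le _ _

/-- For an ergodic measure `ν`, the empirical measures converge to `ν` in `ν`-probability. -/
theorem tendsto_measure_compl_empiricalSet [TopologicalSpace X] [OpensMeasurableSpace X]
    {f : X → X} {ν : ProbabilityMeasure X} (hf : Ergodic f (ν : Measure X))
    {F : Set (ProbabilityMeasure X)} (hF : F ∈ 𝓝 ν) :
    Tendsto (fun n => (ν : Measure X) (empiricalSet f n F)ᶜ) atTop (𝓝 0) := by
  -- Phrased as convergence of a filter, weak convergence can be tested on one function at a time;
  -- the filter axioms absorb the finite intersections.
  have key : Tendsto _root_.id (empiricalFilter f (ν : Measure X)) (𝓝 ν) := by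
    rw [ProbabilityMeasure.tendsto_iff_forall_integral_tendsto]
    intro g
    have hgm : StronglyMeasurable g := g.continuous.measurable.stronglyMeasurable
    have hgL : MemLp g 2 (ν : Measure X) :=
      MemLp.of_bound hgm.aestronglyMeasurable ‖g‖ (Eventually.of_forall g.norm_coe_le_norm)
    have him := hf.tendstoInMeasure_birkhoffAverage hgL
    rw [tendstoInMeasure_iff_dist] at him
    rw [Metric.tendsto_nhds]
    intro ε hε
    change Tendsto (fun n => (ν : Measure X) (empiricalSet f n _)ᶜ) atTop (𝓝 0)
    refine (tendsto_of_tendsto_of_tendsto_of_le_of_le' tendsto_const_nhds (him ε hε)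
      (Eventually.of_forall fun _ => zero_le) ?_)
    filter_upwards [eventually_ne_atTop 0] with n hn
    refine measure_mono fun x hx => ?_
    by_contra hcon
    refine hx ⟨⟨_, isProbabilityMeasure_empiricalMeasure f hn x⟩, ?_, rfl⟩
    have h : ∫ y, g y ∂(empiricalMeasure f n x) = birkhoffAverage ℝ f g n x :=
      integral_empiricalMeasure f n x hgm
    change dist (∫ y, g y ∂(empiricalMeasure f n x)) _ < ε
    rw [h]
    exact not_le.1 hcon
  exact key hF

end Empirical

/-! ### Separating the atoms, and visits to the exceptional set. -/

section Partition

/-- A finite measurable partition of a compact metric space has, outside a set of small measure,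
atoms at a positive distance from each other. -/
theorem exists_dist_le_imp_eq {X : Type*} [MetricSpace X] [CompactSpace X] [MeasurableSpace X]
    [BorelSpace X] (ν : Measure X) [IsProbabilityMeasure ν] {k : ℕ} {ξ : X → Fin k}
    (hξ : Measurable ξ) {γ : ℝ} (hγ : 0 < γ) :
    ∃ ε > 0, ∃ B : Set X, MeasurableSet B ∧ ν.real B ≤ γ ∧
      ∀ x ∉ B, ∀ y ∉ B, dist x y ≤ ε → ξ x = ξ y := by
  have hk : 0 < γ / (k + 1) := by positivity
  -- Inner regularity gives a compact core in each atom. Disjoint cores lie at positive distance,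
  -- and `B` is the complement of their union.
  have hK : ∀ i : Fin k, ∃ K ⊆ ξ ⁻¹' {i}, IsClosed K ∧
      ν (ξ ⁻¹' {i} \ K) < ENNReal.ofReal (γ / (k + 1)) := fun i =>
    (hξ (measurableSet_singleton i)).exists_isClosed_sdiff_lt (measure_ne_top _ _)
      (ENNReal.ofReal_pos.2 hk).ne'
  choose K hKsub hKc hKν using hK
  have hpair : ∀ p : Fin k × Fin k, ∀ᶠ ε in 𝓝[>] (0 : ℝ),
      ∀ x ∈ K p.1, ∀ y ∈ K p.2, dist x y ≤ ε → p.1 = p.2 := by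
    rintro ⟨i, j⟩
    by_cases hij : i = j
    · exact Eventually.of_forall fun _ _ _ _ _ _ => hij
    have hdis : Disjoint (K i) (K j) := by
      rw [Set.disjoint_left]
      intro x hx hy
      exact hij ((hKsub i hx).symm.trans (hKsub j hy))
    obtain ⟨δ, hδ, hd⟩ := hdis.exists_thickenings (hKc i).isCompact (hKc j)
    filter_upwards [Ioo_mem_nhdsGT hδ] with ε hε x hx y hy hxy
    exfalso
    exact Set.disjoint_left.1 hd (Metric.self_subset_thickening hδ _ hx)
      (Metric.mem_thickening_iff.2 ⟨y, hy, hxy.trans_lt hε.2⟩)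
  obtain ⟨ε, hε, hε0⟩ := ((eventually_all.2 hpair).and self_mem_nhdsWithin).exists
  refine ⟨ε, hε0, (⋃ i, K i)ᶜ, (MeasurableSet.iUnion fun i => (hKc i).measurableSet).compl, ?_, ?_⟩
  · have hsub : (⋃ i, K i)ᶜ ⊆ ⋃ i, (ξ ⁻¹' {i} \ K i) := by
      intro x hx
      simp only [Set.mem_compl_iff, Set.mem_iUnion, not_exists] at hx
      exact Set.mem_iUnion.2 ⟨ξ x, rfl, hx _⟩
    calc ν.real (⋃ i, K i)ᶜ ≤ ν.real (⋃ i, (ξ ⁻¹' {i} \ K i)) := measureReal_mono hsub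
      _ ≤ ∑ i, ν.real (ξ ⁻¹' {i} \ K i) := measureReal_iUnion_fintype_le _
      _ ≤ ∑ _i : Fin k, γ / (k + 1) := Finset.sum_le_sum fun i _ =>
          ENNReal.toReal_le_of_le_ofReal hk.le (hKν i).le
      _ ≤ γ := by
          rw [Finset.sum_const, nsmul_eq_mul, Finset.card_univ, Fintype.card_fin, ← mul_div_assoc,
            div_le_iff₀ (by positivity)]
          nlinarith
  · intro x hx y hy hxy
    rw [Set.mem_compl_iff, not_not, Set.mem_iUnion] at hx hy
    obtain ⟨i, hi⟩ := hx
    obtain ⟨j, hj⟩ := hy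
    rw [hKsub i hi, hKsub j hj]
    exact hε (i, j) x hi y hj hxy

open Classical in
/-- Markov's inequality for the frequency of visits to a set. -/
theorem measure_visits_le {X : Type*} [MeasurableSpace X] {ν : Measure X} [IsProbabilityMeasure ν]
    {f : X → X} (hf : MeasurePreserving f ν ν) {B : Set X} (hB : MeasurableSet B) {c : ℝ}
    (hc : 0 < c) {n : ℕ} (hn : n ≠ 0) :
    ν.real {x | c * n ≤ ((Finset.range n).filter fun j => f^[j] x ∈ B).card} ≤ ν.real B / c := by
  have hn' : (0 : ℝ) < n := by exact_mod_cast Nat.pos_of_ne_zero hn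
  have hint : ∀ j, Integrable (fun x => B.indicator (fun _ => (1 : ℝ)) (f^[j] x)) ν := fun j =>
    (hf.iterate j).integrable_comp_of_integrable ((integrable_const 1).indicator hB)
  have hcard : ∀ x, (((Finset.range n).filter fun j => f^[j] x ∈ B).card : ℝ)
      = ∑ j ∈ Finset.range n, B.indicator (fun _ => (1 : ℝ)) (f^[j] x) := by
    intro x
    simp only [Set.indicator_apply]
    rw [Finset.sum_boole]
  have hval : ∀ j, ∫ x, B.indicator (fun _ => (1 : ℝ)) (f^[j] x) ∂ν = ν.real B := by
    intro j
    have := integral_map (μ := ν) (hf.iterate j).measurable.aemeasurable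
      (f := B.indicator (fun _ => (1 : ℝ)))
      ((measurable_const.indicator hB).aestronglyMeasurable)
    rw [← this, (hf.iterate j).map_eq, integral_indicator_const _ hB]
    simp
  have h := mul_meas_ge_le_integral_of_nonneg (μ := ν)
    (f := fun x => ∑ j ∈ Finset.range n, B.indicator (fun _ => (1 : ℝ)) (f^[j] x))
    (Eventually.of_forall fun x => Finset.sum_nonneg fun j _ =>
      Set.indicator_nonneg (fun _ _ => zero_le_one) _)
    (integrable_finsetSum _ fun j _ => hint j) (c * n)
  rw [integral_finsetSum _ fun j _ => hint j] at h
  simp only [hval, Finset.sum_const, Finset.card_range, nsmul_eq_mul] at h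
  simp only [hcard]
  rw [le_div_iff₀ hc]
  refine le_of_mul_le_mul_left ?_ hn'
  calc _ = _ := by ring
    _ ≤ _ := h

end Partition

/-! ### From names to separated orbits. -/

section Separated

open Classical in
/-- If every point of `G` rarely visits `B`, and close points outside `B` have the same label, then
the number of names of points of `G` is controlled by a separated subset of `G`. -/
theorem exists_isDeltaSeparated_card_le {X : Type*} [MetricSpace X] {f : X → X} {k : ℕ}
    {ξ : X → Fin k} {B : Set X} {ε : ℝ}
    (hB : ∀ x ∉ B, ∀ y ∉ B, dist x y ≤ ε → ξ x = ξ y) {n : ℕ} {G : Set X} {c : ℝ} (hc : 0 ≤ c)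
    (hG : ∀ x ∈ G, (((Finset.range n).filter fun j => f^[j] x ∈ B).card : ℝ) ≤ c * n)
    {δ : ℝ} (hδ : 0 ≤ δ) {t : ℝ} (ht0 : 0 < t) (ht1 : t ≤ 1) :
    ∃ Γ : Finset X, (Γ : Set X) ⊆ G ∧ IsDeltaSeparated f δ n ε (Γ : Set X) ∧
      ∃ W : Finset (Fin n → Fin k), (∀ x ∈ G, refinedPartition f ξ n x ∈ W) ∧
        (W.card : ℝ) ≤
          Γ.card * Real.exp ((δ + 2 * c) * n * Real.log t⁻¹ + n * (k * t)) := by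
  set W : Finset (Fin n → Fin k) := (Set.toFinite (refinedPartition f ξ n '' G)).toFinset with hW
  have hWG : (W : Set (Fin n → Fin k)) ⊆ refinedPartition f ξ n '' G := by
    rw [hW, Set.Finite.coe_toFinset]
  -- `G` may be infinite, so maximality is taken inside a finite `R ⊆ G` realising every name.
  obtain ⟨R, hRG, hRW⟩ := Finset.subset_set_image_iff.1 hWG
  obtain ⟨Γ, hΓR, hΓ, hmax⟩ := exists_maximal_pairwise R
    (fun x y => δ * n ≤ (((Finset.range n).filter fun j => ε < dist (f^[j] x) (f^[j] y)).card : ℝ))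
    (fun x y h => by simpa only [dist_comm] using h)
  refine ⟨Γ, fun x hx => hRG (hΓR hx), hΓ, W, fun x hx => ?_, ?_⟩
  · rw [hW, Set.Finite.mem_toFinset]
    exact ⟨x, hx, rfl⟩
  have hham : ∀ x ∈ Γ, ∀ y ∈ R,
      (x = y ∨ ¬ δ * n ≤
        (((Finset.range n).filter fun j => ε < dist (f^[j] x) (f^[j] y)).card : ℝ)) →
      (hammingDist (refinedPartition f ξ n y) (refinedPartition f ξ n x) : ℝ)
        ≤ (δ + 2 * c) * n := by
    intro x hx y hy hxy
    rcases hxy with rfl | hxy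
    · rw [hammingDist_self, Nat.cast_zero]; positivity
    -- Where the names differ, the orbits are more than `ε` apart or one of them is in `B`; hence
    -- the radius `(δ + 2 * c) * n`.
    have hsub : (Finset.univ.filter fun i : Fin n =>
        refinedPartition f ξ n y i ≠ refinedPartition f ξ n x i).map Fin.valEmbedding ⊆
        ((Finset.range n).filter fun j => ε < dist (f^[j] x) (f^[j] y)) ∪
        (((Finset.range n).filter fun j => f^[j] x ∈ B) ∪
          ((Finset.range n).filter fun j => f^[j] y ∈ B)) := by
      intro j hj
      obtain ⟨i, hi, rfl⟩ := Finset.mem_map.1 hj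
      have hne := (Finset.mem_filter.1 hi).2
      simp only [Finset.mem_union, Finset.mem_filter, Finset.mem_range, Fin.valEmbedding_apply,
        i.2, true_and]
      by_contra! hcon
      exact hne (hB _ hcon.2.1 _ hcon.2.2 hcon.1).symm
    have hcard : hammingDist (refinedPartition f ξ n y) (refinedPartition f ξ n x) ≤
        ((Finset.range n).filter fun j => ε < dist (f^[j] x) (f^[j] y)).card +
        (((Finset.range n).filter fun j => f^[j] x ∈ B).card +
          ((Finset.range n).filter fun j => f^[j] y ∈ B).card) := by
      have := Finset.card_le_card hsub
      rw [Finset.card_map] at this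
      refine (le_of_eq ?_).trans (this.trans ((Finset.card_union_le _ _).trans
        (Nat.add_le_add_left (Finset.card_union_le _ _) _)))
      rw [hammingDist]
    have h1 := hG x (hRG (hΓR hx))
    have h2 := hG y (hRG hy)
    have h3 : (hammingDist (refinedPartition f ξ n y) (refinedPartition f ξ n x) : ℝ) ≤ _ :=
      Nat.cast_le.2 hcard
    push_cast at h3
    linarith [not_le.1 hxy]
  have hcover : W ⊆ Γ.biUnion fun x => Finset.univ.filter fun v : Fin n → Fin k =>
      (hammingDist v (refinedPartition f ξ n x) : ℝ) ≤ (δ + 2 * c) * n := by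
    intro w hw
    rw [← hRW, Finset.mem_image] at hw
    obtain ⟨y, hy, rfl⟩ := hw
    obtain ⟨x, hx, hxy⟩ := hmax y hy
    exact Finset.mem_biUnion.2 ⟨x, hx, Finset.mem_filter.2 ⟨Finset.mem_univ _, hham x hx y hy hxy⟩⟩
  calc (W.card : ℝ) ≤ ∑ x ∈ Γ, ((Finset.univ.filter fun v : Fin n → Fin k =>
      (hammingDist v (refinedPartition f ξ n x) : ℝ) ≤ (δ + 2 * c) * n).card : ℝ) := by
        exact_mod_cast (Finset.card_le_card hcover).trans Finset.card_biUnion_le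
    _ ≤ ∑ x ∈ Γ, Real.exp ((δ + 2 * c) * n * Real.log t⁻¹ + n * (k * t)) := by
        refine Finset.sum_le_sum fun x _ => ?_
        have := card_hammingDist_le (refinedPartition f ξ n x) ht0 ht1 ((δ + 2 * c) * n)
        rw [Fintype.card_fin] at this
        convert this
    _ = _ := by rw [Finset.sum_const, nsmul_eq_mul]

theorem measurable_refinedPartition {X ι : Type*} [MeasurableSpace X] [MeasurableSpace ι]
    {f : X → X} (hf : Measurable f) {ξ : X → ι} (hξ : Measurable ξ) (n : ℕ) :
    Measurable (refinedPartition f ξ n) :=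
  measurable_pi_lambda _ fun i => hξ.comp (hf.iterate i)

/-- A partition whose entropy rate exceeds a given number below the entropy. -/
theorem exists_partition_of_lt_ksEntropy {X : Type*} [MeasurableSpace X] {f : X → X}
    {μ : Measure X} {a : ℝ} (ha : (a : EReal) < ksEntropy f μ) :
    ∃ (k : ℕ) (ξ : X → Fin k), Measurable ξ ∧
      ∀ᶠ n : ℕ in atTop, a * n < partitionEntropy μ (refinedPartition f ξ n) := by
  simp only [ksEntropy, lt_iSup_iff] at ha
  obtain ⟨k, ξ, hξ, hrate⟩ := ha
  refine ⟨k, ξ, hξ, ?_⟩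
  filter_upwards [eventually_lt_of_lt_liminf hrate, eventually_gt_atTop 0] with n hn hn0
  have h := EReal.coe_lt_coe_iff.1 hn
  rwa [lt_div_iff₀ (by exact_mod_cast hn0)] at h

end Separated

/-! ### Choice of constants and conclusion. -/

theorem proposition3p3 {X : Type*} [MetricSpace X] [CompactSpace X] [MeasurableSpace X]
    [BorelSpace X] (f : X → X) (hf : Continuous f)
    (ν : ProbabilityMeasure X) (hν : Ergodic f (ν : Measure X))
    (φ : X → ℝ) (hφ : Continuous φ) (η : ℝ) (hη : 0 < η)
    (h : ℝ) (hh : (h : EReal) ≤ ksEntropy f (ν : Measure X)) :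
    ∃ δ : ℝ, 0 < δ ∧ ∃ ε : ℝ, 0 < ε ∧
      ∀ F ∈ 𝓝 ν, ∃ N : ℕ, ∀ n : ℕ, N ≤ n →
        ∃ Γ : Finset X, (Γ : Set X) ⊆ empiricalSet f n F ∧
          IsDeltaSeparated f δ n ε (Γ : Set X) ∧
          Real.exp (n * (h + (∫ x, φ x ∂(ν : Measure X)) - η)) ≤
            ∑ x ∈ Γ, Real.exp (birkhoffSum f φ n x) := by
  classical
  have hlt : ((h - η / 8 : ℝ) : EReal) < ksEntropy f (ν : Measure X) :=
    (EReal.coe_lt_coe_iff.2 (by linarith)).trans_le hh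
  obtain ⟨k, ξ, hξ, hrate⟩ := exists_partition_of_lt_ksEntropy hlt
  have hk : 0 < k := by
    obtain ⟨x⟩ := (ν : Measure X).nonempty_of_neZero
    exact (ξ x).pos
  have hkR : (1 : ℝ) ≤ k := by exact_mod_cast hk
  have hL : 0 ≤ Real.log k := Real.log_nonneg hkR
  obtain ⟨ρ, hρ0, hρ1, hρL⟩ : ∃ ρ : ℝ, 0 < ρ ∧ ρ < 1 ∧ ρ * Real.log k ≤ η / 8 := by
    refine ⟨min (1 / 2) (η / 8 / (Real.log k + 1)), by positivity,
      (min_le_left _ _).trans_lt (by norm_num), ?_⟩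
    calc _ ≤ η / 8 / (Real.log k + 1) * (Real.log k + 1) :=
          mul_le_mul (min_le_right _ _) (by linarith) hL (by positivity)
      _ = η / 8 := div_mul_cancel₀ _ (by positivity)
  obtain ⟨t, ht0, ht1, htk⟩ : ∃ t : ℝ, 0 < t ∧ t ≤ 1 ∧ k * t ≤ η / 8 := by
    refine ⟨min 1 (η / 8 / k), by positivity, min_le_left _ _, ?_⟩
    calc _ ≤ k * (η / 8 / k) := mul_le_mul_of_nonneg_left (min_le_right _ _) (by positivity)
      _ = η / 8 := mul_div_cancel₀ _ (by positivity)
  have hT : 0 ≤ Real.log t⁻¹ := Real.log_nonneg ((one_le_inv₀ ht0).2 ht1)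
  -- `s` serves both as separation frequency and as bound on the frequency of visits to `B`, so the
  -- Hamming radius is `3 s n`.
  obtain ⟨s, hs0, hsT⟩ : ∃ s : ℝ, 0 < s ∧ (s + 2 * s) * Real.log t⁻¹ ≤ η / 8 := by
    refine ⟨η / 24 / (Real.log t⁻¹ + 1), by positivity, ?_⟩
    calc _ ≤ 3 * (η / 24 / (Real.log t⁻¹ + 1) * (Real.log t⁻¹ + 1)) := by
          have : 0 ≤ η / 24 / (Real.log t⁻¹ + 1) := by positivity
          nlinarith
      _ = η / 8 := by rw [div_mul_cancel₀ _ (by positivity)]; ring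
  -- With this `γ`, Markov's inequality at frequency `s` costs `ρ / 3`. The other two exceptional
  -- sets cost `ρ / 4` each, for a total below `ρ`. Neither `s` nor `ε` depends on `F`.
  obtain ⟨ε, hε, B, hBm, hBν, hB⟩ :=
    exists_dist_le_imp_eq (ν : Measure X) hξ (γ := ρ / 3 * s) (by positivity)
  refine ⟨s, hs0, ε, hε, fun F hF => ?_⟩
  have hφL : MemLp φ 2 (ν : Measure X) := by
    obtain ⟨C, hC⟩ := isCompact_univ.exists_bound_of_continuousOn hφ.continuousOn
    exact MemLp.of_bound hφ.measurable.aestronglyMeasurable C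
      (Eventually.of_forall fun x => hC x trivial)
  have hφm := hν.tendstoInMeasure_birkhoffAverage hφL
  rw [tendstoInMeasure_iff_dist] at hφm
  have hsmall : 0 < ENNReal.ofReal (ρ / 4) := ENNReal.ofReal_pos.2 (by positivity)
  rw [← eventually_atTop]
  filter_upwards [hrate, (tendsto_measure_compl_empiricalSet hν hF).eventually_lt_const hsmall,
    (hφm (η / 4) (by positivity)).eventually_lt_const hsmall, eventually_ne_atTop 0,
    tendsto_natCast_atTop_atTop.eventually_ge_atTop (Real.log 2 / (η / 8))] with n hH hF3 hφ3 hn0 hn2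
  have hnpos : (0 : ℝ) < n := by exact_mod_cast Nat.pos_of_ne_zero hn0
  rw [div_le_iff₀ (by positivity)] at hn2
  set I := ∫ x, φ x ∂(ν : Measure X) with hI
  set G : Set X := {x | x ∈ empiricalSet f n F ∧ n * (I - η / 4) ≤ birkhoffSum f φ n x ∧
    (((Finset.range n).filter fun j => f^[j] x ∈ B).card : ℝ) ≤ s * n} with hG
  obtain ⟨Γ, hΓG, hΓsep, W, hGW, hWΓ⟩ := exists_isDeltaSeparated_card_le (f := f) hB (n := n)
    (G := G) hs0.le (fun x hx => hx.2.2) hs0.le ht0 ht1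
  have hcompl : (ν : Measure X).real {x | refinedPartition f ξ n x ∉ W} ≤ ρ := by
    have hsub : {x | refinedPartition f ξ n x ∉ W} ⊆ (empiricalSet f n F)ᶜ ∪
        {x | η / 4 ≤ dist (birkhoffAverage ℝ f φ n x) I} ∪
        {x | s * n ≤ (((Finset.range n).filter fun j => f^[j] x ∈ B).card : ℝ)} := by
      intro x hx
      by_contra hcon
      simp only [Set.mem_union, not_or, Set.mem_compl_iff, not_not] at hcon
      obtain ⟨⟨h1, h2⟩, h3⟩ := hcon
      refine hx (hGW x ⟨h1, ?_, (not_le.1 h3).le⟩)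
      have h2' : dist (birkhoffAverage ℝ f φ n x) I < η / 4 := not_le.1 h2
      rw [Real.dist_eq] at h2'
      have h4 := (abs_lt.1 h2').1
      have h5 : birkhoffSum f φ n x = n * birkhoffAverage ℝ f φ n x := by
        rw [birkhoffAverage, smul_eq_mul, mul_inv_cancel_left₀ hnpos.ne']
      rw [h5]
      exact mul_le_mul_of_nonneg_left (by linarith) hnpos.le
    have hv := measure_visits_le hν.toMeasurePreserving hBm hs0 hn0
    have hv' : (ν : Measure X).real B / s ≤ ρ / 3 := (div_le_iff₀ hs0).2 hBν
    have e1 := ENNReal.toReal_le_of_le_ofReal (by positivity) hF3.le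
    have e2 := ENNReal.toReal_le_of_le_ofReal (by positivity) hφ3.le
    refine (measureReal_mono hsub).trans ((measureReal_union_le _ _).trans ?_)
    have h6 := measureReal_union_le (μ := (ν : Measure X)) (empiricalSet f n F)ᶜ
      {x | η / 4 ≤ dist (birkhoffAverage ℝ f φ n x) I}
    simp only [Measure.real] at *
    linarith
  -- An empty `W` would give the whole space measure at most `ρ < 1`.
  have hWne : W.Nonempty := by
    rw [Finset.nonempty_iff_ne_empty]
    rintro rfl
    simp at hcompl
    linarith
  have hent := partitionEntropy_le (ν : Measure X)
    (measurable_refinedPartition hf.measurable hξ n) hWne hcompl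
  have hcardW : (0 : ℝ) < W.card := by exact_mod_cast hWne.card_pos
  have hcardΓ : (0 : ℝ) < Γ.card :=
    pos_of_mul_pos_left (hcardW.trans_le hWΓ) (Real.exp_pos _).le
  have hlogW : Real.log W.card ≤ Real.log Γ.card + n * (η / 4) := by
    refine (Real.log_le_log hcardW hWΓ).trans ?_
    rw [Real.log_mul hcardΓ.ne' (Real.exp_ne_zero _), Real.log_exp]
    nlinarith
  have hlogN : ρ * Real.log (Fintype.card (Fin n → Fin k)) ≤ n * (η / 8) := by
    rw [Fintype.card_fun, Fintype.card_fin, Fintype.card_fin, Nat.cast_pow, Real.log_pow]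
    nlinarith
  -- Losses in units of `η / 8`: one each for the choice of `ξ`, `log 2` and the labels outside `W`,
  -- and two for the Hamming ball. The Birkhoff sums cost two more, leaving one to spare.
  have hlogΓ : n * (h - 5 * η / 8) ≤ Real.log Γ.card := by nlinarith
  refine ⟨Γ, fun x hx => (hΓG hx).1, hΓsep, ?_⟩
  calc Real.exp (n * (h + I - η))
      ≤ Real.exp (Real.log Γ.card + n * (I - η / 4)) := Real.exp_le_exp.2 (by nlinarith)
    _ = Γ.card * Real.exp (n * (I - η / 4)) := by rw [Real.exp_add, Real.exp_log hcardΓ]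
    _ = ∑ _x ∈ Γ, Real.exp (n * (I - η / 4)) := by rw [Finset.sum_const, nsmul_eq_mul]
    _ ≤ _ := Finset.sum_le_sum fun x hx => Real.exp_le_exp.2 (hΓG hx).2.1
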